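/- Throughout, graphs are finite and simple. Let $G$ be a graph of size $q$. For a bijection $f:E(G)\to\{1,\dots,q\}$ and a vertex $v$ let $f^+(v)$ be the sum of the labels of the edges incident to $v$. Call $f$ a local antimagic labeling if $f^+(u)\ne f^+(v)$ for all adjacent $u,v$. The local antimagic chromatic number $\chi_{la}(G)$ is the minimum, over all local antimagic labelings $f$ of $G$, of the number of distinct values of $f^+$ on $V(G)$. The lexicographic product $G[H]$ has vertex set $V(G)\times V(H)$, and $(u,u')$ is adjacent to $(v,v')$ if $uv\in E(G)$, or if $u=v$ and $u'v'\in E(H)$. Let $O_t$ denote the null (edgeless) graph on $t$ vertices. Theorem. Let $G$ be a graph that is connected and Eulerian (it has a closed trail traversing every edge exactly once) and has chromatic number $\chi(G)=3$. Suppose that $V(G)$ is the disjoint union of three independent sets $V_1=\{w\}$, $V_2$ and $V_3$ with $|V_2|\ge 2$ and $|V_3|\ge 2$, and that there are integers $a,b\ge 1$ and $m,n$ such that $w$ is adjacent to exactly $2a$ vertices of $V_2$ and exactly $2b$ vertices of $V_3$, every vertex of $V_2$ has degree $2m$, and every vertex of $V_3$ has degree $2n$. Then for every integer $t\ge 3$,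 $$\chi_{la}(G[O_t])=3.$$ -/

import Mathlib

namespace LocalAntimagic

universe u v

/-- The lexicographic product `G[H]`. -/
def lexProduct {V : Type u} {W : Type v} (G : SimpleGraph V) (H : SimpleGraph W) :
    SimpleGraph (V × W) where
  Adj p q := G.Adj p.1 q.1 ∨ (p.1 = q.1 ∧ H.Adj p.2 q.2)
  symm := ⟨by
    rintro p q (h | ⟨h, h'⟩)
    · exact Or.inl h.symm
    · exact Or.inr ⟨h.symm, h'.symm⟩⟩
  loopless := ⟨by
    rintro p (h | ⟨_, h⟩)
    · exact G.irrefl h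
    · exact H.irrefl h⟩

/-- The null graph `O_t` on `t` vertices. -/
abbrev nullGraph (t : ℕ) : SimpleGraph (Fin t) := ⊥

open Classical in
/-- The induced vertex color `f⁺(x)`: the sum of the labels of the edges incident to `x`.
Only the values of `f` on edges of `G` matter. -/
noncomputable def vertexSum {V : Type u} [Fintype V] (G : SimpleGraph V) (f : Sym2 V → ℕ)
    (x : V) : ℕ :=
  ∑ e with e ∈ G.incidenceSet x, f e

/-- `f` restricts to a bijection from the edge set of `G` onto `{1, …, q}`, where `q` is the
number of edges, and adjacent vertices get distinct induced colors. -/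
structure IsLocalAntimagic {V : Type u} [Fintype V] (G : SimpleGraph V) (f : Sym2 V → ℕ) :
    Prop where
  bijOn : Set.BijOn f G.edgeSet (Set.Icc 1 G.edgeSet.ncard)
  vertexSum_ne : ∀ x y : V, G.Adj x y → vertexSum G f x ≠ vertexSum G f y

/-- The number of distinct induced vertex colors. -/
noncomputable def numColors {V : Type u} [Fintype V] (G : SimpleGraph V) (f : Sym2 V → ℕ) : ℕ :=
  (Set.range (vertexSum G f)).ncard

/-- The local antimagic chromatic number: the minimum number of induced colors over all local
antimagic labelings, and `⊤` if there is no such labeling. -/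
noncomputable def chiLa {V : Type u} [Fintype V] (G : SimpleGraph V) : ℕ∞ :=
  ⨅ (f : Sym2 V → ℕ) (_ : IsLocalAntimagic G f), (numColors G f : ℕ∞)

/-- A connected graph having a closed walk that traverses every edge exactly once. -/
def IsEulerianGraph {V : Type u} [DecidableEq V] (G : SimpleGraph V) : Prop :=
  G.Connected ∧ ∃ (x : V) (p : G.Walk x x), p.IsEulerian

/-- Finite graphs with tripartition `{w}`, `V₂`, `V₃` where `|V₂|, |V₃| ≥ 2`, such that `w` has
`2a ≥ 2` neighbors in `V₂` and `2b ≥ 2` neighbors in `V₃`, all vertices of `V₂` have degree `2m`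
and all vertices of `V₃` have degree `2n`. -/
structure EvenTripartition {V : Type u} [Fintype V] [DecidableEq V] (G : SimpleGraph V)
    [DecidableRel G.Adj] (w : V) (V₂ V₃ : Finset V) (a b m n : ℕ) : Prop where
  union_eq : {w} ∪ V₂ ∪ V₃ = Finset.univ
  not_mem₂ : w ∉ V₂
  not_mem₃ : w ∉ V₃
  disjoint : Disjoint V₂ V₃
  indep₂ : ∀ x ∈ V₂, ∀ y ∈ V₂, ¬ G.Adj x y
  indep₃ : ∀ x ∈ V₃, ∀ y ∈ V₃, ¬ G.Adj x y
  two_le_card₂ : 2 ≤ V₂.card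
  two_le_card₃ : 2 ≤ V₃.card
  one_le_a : 1 ≤ a
  one_le_b : 1 ≤ b
  card_nbrs₂ : (G.neighborFinset w ∩ V₂).card = 2 * a
  card_nbrs₃ : (G.neighborFinset w ∩ V₃).card = 2 * b
  degree₂ : ∀ x ∈ V₂, G.degree x = 2 * m
  degree₃ : ∀ x ∈ V₃, G.degree x = 2 * n

end LocalAntimagic

namespace LocalAntimagic

/-! Lower bound: the vertices of `G[O_t]` with a fixed second coordinate induce a copy of `G`, which
the vertex sums properly colour, so at least `χ(G) = 3` values occur.

Upper bound: orient `G` by `V₂ < w < V₃` and split each vertex into a left copy, carrying its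
outgoing edges, and a right copy, carrying its incoming ones. Only `w` has edges at both copies,
`2b` on the left and `2a` on the right, so all degrees stay even. If the copies of `w` lay in
different components, `G` would be 2-colourable (`reachable_root`); hence all edges lie in one
component, and there is an Eulerian circuit, of length `2k`, based at the right copy of `w`.

Each edge of `G` becomes `T = t²` edges of `G[O_t]`. Along the circuit, these blocks take labels
alternately from the bottom and the top of `1, …, 2kT`. A visit to a vertex pairs two consecutive
blocks cell by cell, with cell sum `2kT + 1` on the left and `2kT + 1 + T` on the right, except that
the visit where the circuit closes loses `Tk` (`vertexSum_blockLabeling_eq`). After division by `t`,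
the sums on `V₂`, `V₃` and `w` are congruent to `0`, `nT` and `(a - k)T` modulo `2kT + 1`, which
separates adjacent vertices. -/

open SimpleGraph Finset

/-! ### Eulerian circuits and sums along them -/

/-- A trail that uses every edge at its initial vertex `u`, of even degree, is closed. -/
theorem eq_of_isTrail_of_incident_mem {V : Type*} [Fintype V] [DecidableEq V]
    {H : SimpleGraph V} [DecidableRel H.Adj] {u v : V} {p : H.Walk u v} (hp : p.IsTrail)
    (heven : Even (H.degree u)) (h : ∀ y, H.Adj u y → s(u, y) ∈ p.edges) : u = v := by
  by_contra huv
  have hcount : p.edges.countP (fun e => u ∈ e) = H.degree u := by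
    rw [← Multiset.coe_countP, Multiset.countP_eq_card_filter, ← card_incidenceFinset_eq_degree]
    change Multiset.card (hp.edgesFinset.filter (u ∈ ·)).val = _
    change #(hp.edgesFinset.filter (u ∈ ·)) = _
    congr 1
    ext e
    rw [H.incidenceFinset_eq_filter u]
    simp only [mem_filter, mem_edgeFinset]
    refine ⟨fun he => ⟨p.edges_subset_edgeSet he.1, he.2⟩, fun he => ⟨?_, he.2⟩⟩
    obtain ⟨he1, y, rfl⟩ := he
    exact h y he1
  rw [← hcount, hp.even_countP_edges_iff] at heven
  exact (heven huv).1 rfl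

/-- A finite graph with even degrees whose edges all lie in the component of `r` has a closed
Eulerian walk at `r`. -/
theorem exists_closed_isEulerian {V : Type*} [Fintype V] [DecidableEq V]
    (H : SimpleGraph V) [DecidableRel H.Adj] (r : V) (heven : ∀ x, Even (H.degree x))
    (hconn : ∀ x y, H.Adj x y → H.Reachable r x) : ∃ p : H.Walk r r, p.IsEulerian := by
  -- A longest trail in the component of `r` cannot be extended at its start, so it uses every edge
  -- there and is closed.
  let S : Set ℕ := {n | ∃ (u v : V) (p : H.Walk u v), H.Reachable r u ∧ p.IsTrail ∧ p.length = n}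
  have hne : S.Nonempty := ⟨0, r, r, Walk.nil, .rfl, by simp, rfl⟩
  have hbdd : BddAbove S := by
    refine ⟨#H.edgeFinset, ?_⟩
    rintro _ ⟨u, v, p, -, hp, rfl⟩
    exact hp.length_le_card_edgeFinset
  obtain ⟨u, v, p, hru, hp, hlen⟩ := Nat.sSup_mem hne hbdd
  have hmax : ∀ {x y z : V} (p' : H.Walk x y), H.Reachable r x → p'.IsTrail →
      p'.length = p.length → H.Adj x z → s(x, z) ∈ p'.edges := by
    intro x y z p' hrx hp' hl hxz
    by_contra hnot
    have hmem : p'.length + 1 ∈ S := by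
      refine ⟨z, y, Walk.cons hxz.symm p', hrx.trans hxz.reachable, ?_, by simp⟩
      rw [Walk.isTrail_cons]
      exact ⟨hp', by rwa [Sym2.eq_swap]⟩
    have := le_csSup hbdd hmem
    omega
  obtain rfl : u = v := eq_of_isTrail_of_incident_mem hp (heven u) fun y hy =>
    hmax p hru hp rfl hy
  -- Rotation makes any visited vertex the start of an equally long trail, so maximality applies at
  -- each of them.
  have hmem : ∀ {x z : V}, x ∈ p.support → H.Adj x z → s(x, z) ∈ p.edges := by
    intro x z hx hxz
    have hl : (p.rotate x hx).length = p.length := by simp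
    have := hmax (p.rotate x hx) (hru.trans ⟨p.takeUntil x hx⟩) (hp.rotate hx) hl hxz
    exact (p.rotate_edges x hx).mem_iff.1 this
  have hsupp : ∀ {x y : V}, H.Walk x y → x ∈ p.support → y ∈ p.support := by
    intro x y s
    induction s with
    | nil => exact id
    | cons h _ ih => exact fun hx => ih (p.snd_mem_support_of_mem_edges (hmem hx h))
  have hr : r ∈ p.support := by
    obtain ⟨s⟩ := hru.symm
    exact hsupp s p.start_mem_support
  refine ⟨p.rotate r hr, (hp.rotate hr).isEulerian_of_forall_mem fun e he => ?_⟩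
  induction e with
  | h x y =>
    obtain ⟨s⟩ := hconn x y he
    exact (p.rotate_edges r hr).mem_iff.2 (hmem (hsupp s hr) he)

/-- Sum over the edges at `z` of a function of their positions on an Eulerian walk. -/
theorem sum_neighborFinset_idxOf {V : Type*} [Fintype V] [DecidableEq V]
    {H : SimpleGraph V} [DecidableRel H.Adj] {r : V} {p : H.Walk r r} (hp : p.IsEulerian)
    (z : V) (g : ℕ → ℕ) :
    ∑ y ∈ H.neighborFinset z, g (p.edges.idxOf s(z, y)) =
      ∑ i ∈ range p.length with p.getVert i = z,
        (g i + g (if i = 0 then p.length - 1 else i - 1)) := by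
  have hnd := hp.isTrail.edges_nodup
  have hlen := p.length_edges
  have h1 : ∑ y ∈ H.neighborFinset z, g (p.edges.idxOf s(z, y)) =
      ∑ i ∈ range p.length with z ∈ s(p.getVert i, p.getVert (i + 1)), g i := by
    refine sum_bij (fun y _ => p.edges.idxOf s(z, y)) ?_ ?_ ?_ (fun _ _ => rfl)
    · intro y hy
      have he : s(z, y) ∈ p.edges := hp.mem_edges_iff.2 (by simpa using hy)
      have hlt := List.idxOf_lt_length_iff.2 he
      rw [mem_filter, mem_range, ← p.getElem_edges hlt, List.getElem_idxOf]
      exact ⟨by omega, by simp⟩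
    · intro y hy y' hy' h
      have he : s(z, y) ∈ p.edges := hp.mem_edges_iff.2 (by simpa using hy)
      have := (List.idxOf_inj he).1 h
      exact Sym2.congr_right.1 this
    · intro i hi
      rw [mem_filter, mem_range] at hi
      have hi' : i < p.edges.length := by omega
      obtain ⟨y, hy⟩ := hi.2
      have hget := p.getElem_edges hi'
      refine ⟨y, ?_, ?_⟩
      · rw [mem_neighborFinset, ← mem_edgeSet, ← hy, ← hget]
        exact p.edges_subset_edgeSet (List.getElem_mem _)
      · rw [← hy, ← hget]
        exact hnd.idxOf_getElem _ _
  have h2 : ∑ i ∈ range p.length with z ∈ s(p.getVert i, p.getVert (i + 1)), g i =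
      ∑ i ∈ range p.length with p.getVert i = z, g i +
        ∑ i ∈ range p.length with p.getVert (i + 1) = z, g i := by
    simp only [sum_filter, ← sum_add_distrib]
    refine sum_congr rfl fun i hi => ?_
    have hne := (p.adj_getVert_succ (mem_range.1 hi)).ne
    grind
  -- Cyclic shift of the index: the walk is closed, so the edge entering its last vertex is the one
  -- preceding position `0`.
  have h3 : ∑ i ∈ range p.length with p.getVert (i + 1) = z, g i =
      ∑ i ∈ range p.length with p.getVert i = z,
        g (if i = 0 then p.length - 1 else i - 1) := by
    simp only [sum_filter]
    rcases hq : p.length with _ | q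
    · simp
    · rw [sum_range_succ, sum_range_succ']
      have hlast : p.getVert (q + 1) = r := by rw [← hq, p.getVert_length]
      simp [hlast]
  rw [h1, h2, h3, sum_add_distrib]

theorem degree_eq_two_mul_card_getVert {V : Type*} [Fintype V] [DecidableEq V]
    {H : SimpleGraph V} [DecidableRel H.Adj] {r : V} {p : H.Walk r r} (hp : p.IsEulerian)
    (z : V) : H.degree z = 2 * #{i ∈ range p.length | p.getVert i = z} := by
  have := sum_neighborFinset_idxOf hp z (fun _ => 1)
  simp only [sum_const, smul_eq_mul, mul_one, card_neighborFinset_eq_degree] at this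
  omega

/-! ### The split graph -/

/-- The bipartite graph on two copies of `V` in which the left copy of `x` is joined to the right
copy of `y` when `x` and `y` are adjacent in `G` and `ρ x < ρ y`. -/
def splitGraph {V : Type*} (G : SimpleGraph V) (ρ : V → ℕ) : SimpleGraph (V ⊕ V) where
  Adj p q := match p, q with
    | .inl x, .inr y => G.Adj x y ∧ ρ x < ρ y
    | .inr y, .inl x => G.Adj x y ∧ ρ x < ρ y
    | _, _ => False
  symm := ⟨by rintro (x | x) (y | y) h <;> exact h⟩
  loopless := ⟨by rintro (x | x) h <;> exact h⟩

section splitGraph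

variable {V : Type*} {G : SimpleGraph V} {ρ : V → ℕ}

@[simp] theorem splitGraph_adj_inl_inr {x y : V} :
    (splitGraph G ρ).Adj (.inl x) (.inr y) ↔ G.Adj x y ∧ ρ x < ρ y := Iff.rfl

@[simp] theorem splitGraph_adj_inr_inl {x y : V} :
    (splitGraph G ρ).Adj (.inr y) (.inl x) ↔ G.Adj x y ∧ ρ x < ρ y := Iff.rfl

@[simp] theorem splitGraph_not_adj_inl_inl {x y : V} :
    ¬ (splitGraph G ρ).Adj (.inl x) (.inl y) := id

@[simp] theorem splitGraph_not_adj_inr_inr {x y : V} :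
    ¬ (splitGraph G ρ).Adj (.inr x) (.inr y) := id

/-- The graph is bipartite and the walk starts on the right, so parity of position tells the two
sides apart. -/
theorem splitGraph_isRight_getVert {w : V} {z : V ⊕ V} (p : (splitGraph G ρ).Walk (.inr w) z)
    {i : ℕ} (hi : i ≤ p.length) : (p.getVert i).isRight ↔ Even i := by
  induction i with
  | zero => simp
  | succ i ih =>
    have hadj := p.adj_getVert_succ (i := i) (by omega)
    rw [Nat.even_add_one, ← ih (by omega)]
    generalize p.getVert i = u at *
    generalize p.getVert (i + 1) = v at *
    rcases u with u | u <;> rcases v with v | v <;> simp_all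

variable [Fintype V] [DecidableRel G.Adj] [DecidableRel (splitGraph G ρ).Adj]

theorem sum_neighborFinset_inl (x : V) (F : V ⊕ V → ℕ) :
    ∑ z ∈ (splitGraph G ρ).neighborFinset (.inl x), F z =
      ∑ y with G.Adj x y ∧ ρ x < ρ y, F (.inr y) := by
  have : (splitGraph G ρ).neighborFinset (.inl x) =
      ({y | G.Adj x y ∧ ρ x < ρ y} : Finset V).map ⟨Sum.inr, Sum.inr_injective⟩ := by
    ext (y | y) <;> simp
  rw [this, sum_map]
  rfl

theorem sum_neighborFinset_inr (x : V) (F : V ⊕ V → ℕ) :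
    ∑ z ∈ (splitGraph G ρ).neighborFinset (.inr x), F z =
      ∑ y with G.Adj x y ∧ ρ y < ρ x, F (.inl y) := by
  have : (splitGraph G ρ).neighborFinset (.inr x) =
      ({y | G.Adj x y ∧ ρ y < ρ x} : Finset V).map ⟨Sum.inl, Sum.inl_injective⟩ := by
    ext (y | y) <;> simp [G.adj_comm]
  rw [this, sum_map]
  rfl

theorem degree_splitGraph_inl (x : V) :
    (splitGraph G ρ).degree (.inl x) = #{y | G.Adj x y ∧ ρ x < ρ y} := by
  have := sum_neighborFinset_inl (G := G) (ρ := ρ) x (fun _ => 1)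
  simpa using this

theorem degree_splitGraph_inr (x : V) :
    (splitGraph G ρ).degree (.inr x) = #{y | G.Adj x y ∧ ρ y < ρ x} := by
  have := sum_neighborFinset_inr (G := G) (ρ := ρ) x (fun _ => 1)
  simpa using this

end splitGraph

theorem vertexSum_eq_sum_adj {V : Type*} [Fintype V] (G : SimpleGraph V) [DecidableRel G.Adj]
    (f : Sym2 V → ℕ) (x : V) : vertexSum G f x = ∑ y with G.Adj x y, f s(x, y) := by
  classical
  unfold vertexSum
  symm
  refine sum_bij (fun y _ => s(x, y)) ?_ ?_ ?_ (fun _ _ => rfl)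
  · intro y hy
    simpa using hy
  · intro y _ y' _ h
    exact Sym2.congr_right.1 h
  · intro e he
    simp only [mem_filter, mem_univ, true_and] at he
    obtain ⟨he, y, rfl⟩ := he
    exact ⟨y, by simpa using he, rfl⟩

/-! ### Block labels and their consecutive sums -/

/-- The number in cell `σ` of the `i`-th block: blocks with even `i` fill `1, 2, …` from below,
blocks with odd `i` fill `N, N - 1, …` from above, each taking `T` numbers. -/
def cellLabel (T N i σ : ℕ) : ℕ :=
  if Even i then T * (i / 2) + σ + 1 else N - (T * (i / 2) + σ)

theorem mul_add_inj_of_lt {T j j' σ σ' : ℕ} (hσ : σ < T) (hσ' : σ' < T)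
    (h : T * j + σ = T * j' + σ') : j = j' ∧ σ = σ' := by
  have h1 : (T * j + σ) / T = j := by
    rw [Nat.mul_add_div (by omega), Nat.div_eq_of_lt hσ, add_zero]
  have h2 : (T * j' + σ') / T = j' := by
    rw [Nat.mul_add_div (by omega), Nat.div_eq_of_lt hσ', add_zero]
  have hj : j = j' := by rw [← h1, ← h2, h]
  subst hj
  exact ⟨rfl, by omega⟩

theorem mul_add_lt_mul {T k j σ : ℕ} (hj : j < k) (hσ : σ < T) : T * j + σ < T * k := by
  have : T * (j + 1) ≤ T * k := Nat.mul_le_mul_left T hj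
  rw [mul_add] at this
  omega

theorem cellLabel_two_mul (T N j σ : ℕ) : cellLabel T N (2 * j) σ = T * j + σ + 1 := by
  simp [cellLabel]

theorem cellLabel_two_mul_add_one (T N j σ : ℕ) :
    cellLabel T N (2 * j + 1) σ = N - (T * j + σ) := by
  have : (2 * j + 1) / 2 = j := by omega
  simp [cellLabel, this]

theorem cellLabel_mem_Icc {T k i σ : ℕ} (hi : i < 2 * k) (hσ : σ < T) :
    cellLabel T (T * (2 * k)) i σ ∈ Set.Icc 1 (T * (2 * k)) := by
  have hk : T * (2 * k) = 2 * (T * k) := by ring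
  have := mul_add_lt_mul (T := T) (k := k) (j := i / 2) (by omega) hσ
  rw [Set.mem_Icc, cellLabel]
  split_ifs <;> omega

theorem cellLabel_inj {T k i i' σ σ' : ℕ} (hi : i < 2 * k) (hi' : i' < 2 * k) (hσ : σ < T)
    (hσ' : σ' < T)
    (h : cellLabel T (T * (2 * k)) i σ = cellLabel T (T * (2 * k)) i' σ') : i = i' ∧ σ = σ' := by
  have hk : T * (2 * k) = 2 * (T * k) := by ring
  have h1 := mul_add_lt_mul (T := T) (k := k) (j := i / 2) (by omega) hσ
  have h2 := mul_add_lt_mul (T := T) (k := k) (j := i' / 2) (by omega) hσ'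
  have h3 := mul_add_inj_of_lt (j := i / 2) (j' := i' / 2) hσ hσ'
  simp only [cellLabel, Nat.even_iff] at h
  split_ifs at h
  · have := h3 (by omega); omega
  · omega
  · omega
  · have := h3 (by omega); omega

theorem exists_cellLabel_eq {T k n : ℕ} (hn : n ∈ Set.Icc 1 (T * (2 * k))) :
    ∃ i < 2 * k, ∃ σ < T, cellLabel T (T * (2 * k)) i σ = n := by
  obtain ⟨h1, h2⟩ := hn
  have hk : T * (2 * k) = 2 * (T * k) := by ring
  have hT : 0 < T := by
    rcases Nat.eq_zero_or_pos T with rfl | h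
    · simp at h2; omega
    · exact h
  rcases le_or_gt n (T * k) with h | h
  · refine ⟨2 * ((n - 1) / T), ?_, (n - 1) % T, Nat.mod_lt _ hT, ?_⟩
    · have : (n - 1) / T < k := Nat.div_lt_of_lt_mul (by omega)
      omega
    · rw [cellLabel_two_mul, Nat.div_add_mod]
      omega
  · refine ⟨2 * ((T * (2 * k) - n) / T) + 1, ?_, (T * (2 * k) - n) % T, Nat.mod_lt _ hT, ?_⟩
    · have : (T * (2 * k) - n) / T < k := Nat.div_lt_of_lt_mul (by omega)
      omega
    · rw [cellLabel_two_mul_add_one, Nat.div_add_mod]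
      omega

/-- Both blocks have the same quotient by `2`; one counts up and the other down, so `σ` cancels. -/
theorem cellLabel_add_pred_of_odd {T k i σ : ℕ} (hi : i < 2 * k) (hσ : σ < T) (hodd : ¬ Even i) :
    cellLabel T (T * (2 * k)) i σ + cellLabel T (T * (2 * k)) (i - 1) σ =
      T * (2 * k) + 1 := by
  obtain ⟨j, rfl⟩ := Nat.not_even_iff_odd.1 hodd
  have hk : T * (2 * k) = 2 * (T * k) := by ring
  have := mul_add_lt_mul (T := T) (k := k) (j := j) (by omega) hσ
  rw [cellLabel_two_mul_add_one, Nat.add_sub_cancel, cellLabel_two_mul]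
  omega

/-- The ascending block is one step further along than the descending one, which adds `T`. -/
theorem cellLabel_add_pred_of_even {T k i σ : ℕ} (hi : i < 2 * k) (hσ : σ < T) (heven : Even i)
    (h0 : i ≠ 0) :
    cellLabel T (T * (2 * k)) i σ + cellLabel T (T * (2 * k)) (i - 1) σ =
      T * (2 * k) + 1 + T := by
  obtain ⟨j, rfl⟩ := heven.two_dvd
  obtain ⟨j, rfl⟩ := Nat.exists_eq_succ_of_ne_zero (show j ≠ 0 by omega)
  have hk : T * (2 * k) = 2 * (T * k) := by ring
  have := mul_add_lt_mul (T := T) (k := k) (j := j) (by omega) hσ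
  have h1 : 2 * j.succ - 1 = 2 * j + 1 := by omega
  rw [h1, cellLabel_two_mul_add_one, cellLabel_two_mul, Nat.mul_succ]
  omega

/-- Where the circuit closes, the ascending block restarts at quotient `0` instead of `k`; hence the
deficit `T * k`. -/
theorem cellLabel_zero_add_last {T k σ : ℕ} (hk0 : 0 < k) (hσ : σ < T) :
    cellLabel T (T * (2 * k)) 0 σ + cellLabel T (T * (2 * k)) (2 * k - 1) σ + T * k =
      T * (2 * k) + 1 + T := by
  obtain ⟨k, rfl⟩ := Nat.exists_eq_succ_of_ne_zero hk0.ne'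
  have hk : T * (2 * k.succ) = 2 * (T * k.succ) := by ring
  have := mul_add_lt_mul (T := T) (k := k.succ) (j := k) (by omega) hσ
  have h1 : 2 * k.succ - 1 = 2 * k + 1 := by omega
  have h2 := cellLabel_two_mul T (T * (2 * k.succ)) 0 σ
  rw [mul_zero] at h2
  rw [h1, cellLabel_two_mul_add_one, h2]
  have h3 := Nat.mul_succ T k
  omega

/-! ### The labeling of the lexicographic product -/

/-- The label of the edge from `P` to `Q` (with `P` of smaller rank) when `k` is half the number
of edges of `G` and `es` lists these edges. -/
def arcLabel {V : Type*} [DecidableEq V] (es : List (Sym2 (V ⊕ V))) (t k : ℕ)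
    (P Q : V × Fin t) : ℕ :=
  cellLabel (t * t) (t * t * (2 * k)) (es.idxOf s(.inl P.1, .inr Q.1)) (finProdFinEquiv (P.2, Q.2))

/-- The edge labeling of `G[O_t]` given by `arcLabel`, each edge being oriented along `ρ`. -/
def blockLabeling {V : Type*} [DecidableEq V] (ρ : V → ℕ) (es : List (Sym2 (V ⊕ V))) (t k : ℕ) :
    Sym2 (V × Fin t) → ℕ :=
  Sym2.lift ⟨fun P Q => if ρ P.1 < ρ Q.1 then arcLabel es t k P Q
    -- The value `0` is used only for equal ranks, which never occur on an edge once `ρ` separates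
    -- adjacent vertices.
    else if ρ Q.1 < ρ P.1 then arcLabel es t k Q P else 0, by
      intro P Q
      rcases lt_trichotomy (ρ P.1) (ρ Q.1) with h | h | h
      · simp [h, h.not_gt]
      · simp [h]
      · simp [h, h.not_gt]⟩

section

variable {V : Type*} [DecidableEq V] {ρ : V → ℕ} {es : List (Sym2 (V ⊕ V))}
  {t k : ℕ} {P Q : V × Fin t}

theorem blockLabeling_of_lt (h : ρ P.1 < ρ Q.1) :
    blockLabeling ρ es t k s(P, Q) = arcLabel es t k P Q := by
  simp [blockLabeling, h]

theorem blockLabeling_of_gt (h : ρ Q.1 < ρ P.1) :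
    blockLabeling ρ es t k s(P, Q) = arcLabel es t k Q P := by
  rw [Sym2.eq_swap, blockLabeling_of_lt h]

end

theorem lexProduct_nullGraph_adj {V : Type*} {G : SimpleGraph V} {t : ℕ} {P Q : V × Fin t} :
    (lexProduct G (nullGraph t)).Adj P Q ↔ G.Adj P.1 Q.1 := by
  simp [lexProduct]

theorem exists_arc_of_mem_edgeSet {V : Type*} {G : SimpleGraph V} {ρ : V → ℕ} {t : ℕ}
    (hρ : ∀ x y, G.Adj x y → ρ x ≠ ρ y)
    {e : Sym2 (V × Fin t)}
    (he : e ∈ (lexProduct G (nullGraph t)).edgeSet) :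
    ∃ P Q : V × Fin t, e = s(P, Q) ∧ G.Adj P.1 Q.1 ∧ ρ P.1 < ρ Q.1 := by
  induction e with
  | h P Q =>
    rw [mem_edgeSet, lexProduct_nullGraph_adj] at he
    rcases (hρ _ _ he).lt_or_gt with h | h
    · exact ⟨P, Q, rfl, he, h⟩
    · exact ⟨Q, P, Sym2.eq_swap, he.symm, h⟩

theorem idxOf_lt_of_adj {V : Type*} [DecidableEq V] {G : SimpleGraph V} {ρ : V → ℕ} {w : V}
    {p : (splitGraph G ρ).Walk (.inr w) (.inr w)} {k : ℕ} (hp : p.IsEulerian) (hk : p.length = 2 * k)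
    {x y : V} (h : G.Adj x y) (hlt : ρ x < ρ y) : p.edges.idxOf s(.inl x, .inr y) < 2 * k := by
  rw [← hk, ← p.length_edges, List.idxOf_lt_length_iff, hp.mem_edges_iff]
  exact ⟨h, hlt⟩

theorem blockLabeling_bijOn {V : Type*} [DecidableEq V] {G : SimpleGraph V} {ρ : V → ℕ} {w : V}
    {p : (splitGraph G ρ).Walk (.inr w) (.inr w)} {t k : ℕ}
    (hρ : ∀ x y, G.Adj x y → ρ x ≠ ρ y) (hp : p.IsEulerian)
    (hk : p.length = 2 * k) :
    Set.BijOn (blockLabeling ρ p.edges t k) (lexProduct G (nullGraph t)).edgeSet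
      (Set.Icc 1 (t * t * (2 * k))) := by
  refine ⟨?_, ?_, ?_⟩
  · intro e he
    obtain ⟨P, Q, rfl, hadj, hlt⟩ := exists_arc_of_mem_edgeSet hρ he
    rw [blockLabeling_of_lt hlt]
    exact cellLabel_mem_Icc (idxOf_lt_of_adj hp hk hadj hlt) (Fin.is_lt _)
  · intro e he e' he' h
    obtain ⟨P, Q, rfl, hadj, hlt⟩ := exists_arc_of_mem_edgeSet hρ he
    obtain ⟨P', Q', rfl, hadj', hlt'⟩ := exists_arc_of_mem_edgeSet hρ he'
    rw [blockLabeling_of_lt hlt, blockLabeling_of_lt hlt'] at h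
    obtain ⟨h1, h2⟩ := cellLabel_inj (idxOf_lt_of_adj hp hk hadj hlt)
      (idxOf_lt_of_adj hp hk hadj' hlt') (Fin.is_lt _) (Fin.is_lt _) h
    have hmem : s(Sum.inl P.1, Sum.inr Q.1) ∈ p.edges := hp.mem_edges_iff.2 ⟨hadj, hlt⟩
    have h3 := (List.idxOf_inj hmem).1 h1
    have h4 := finProdFinEquiv.injective (Fin.ext h2)
    simp only [Sym2.eq_iff, Sum.inl.injEq, Sum.inr.injEq, reduceCtorEq, and_self,
      or_false] at h3
    rw [Prod.mk.injEq] at h4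
    rw [Prod.ext h3.1 h4.1, Prod.ext h3.2 h4.2]
  · intro n hn
    obtain ⟨i, hi, σ, hσ, rfl⟩ := exists_cellLabel_eq hn
    have hi' : i < p.edges.length := by rw [p.length_edges]; omega
    obtain ⟨⟨r, c⟩, hrc⟩ := finProdFinEquiv.surjective (⟨σ, hσ⟩ : Fin (t * t))
    obtain ⟨x, y, hxy, hget⟩ : ∃ x y, (G.Adj x y ∧ ρ x < ρ y) ∧
        p.edges[i] = s(.inl x, .inr y) := by
      have := p.edges_subset_edgeSet (List.getElem_mem hi')
      generalize p.edges[i] = e at this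
      induction e with
      | h u v =>
        rcases u with u | u <;> rcases v with v | v
        · exact this.elim
        · exact ⟨u, v, this, rfl⟩
        · exact ⟨v, u, this, Sym2.eq_swap⟩
        · exact this.elim
    refine ⟨s((x, r), (y, c)), lexProduct_nullGraph_adj.2 hxy.1, ?_⟩
    rw [blockLabeling_of_lt hxy.2, arcLabel, ← hget, hp.isTrail.edges_nodup.idxOf_getElem, hrc]

section

variable {V : Type*} [Fintype V] [DecidableEq V] {G : SimpleGraph V}
  {ρ : V → ℕ} {w : V}
  {p : (splitGraph G ρ).Walk (.inr w) (.inr w)} {t k : ℕ}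

/-- Outgoing blocks contribute their row `r` and incoming blocks their column `r`. Each copy thus
uses the same cells in all its blocks, so that consecutive blocks can be added cell by cell. -/
theorem vertexSum_blockLabeling [DecidableRel G.Adj] [DecidableRel (splitGraph G ρ).Adj]
    (hρ : ∀ x y, G.Adj x y → ρ x ≠ ρ y) (es : List (Sym2 (V ⊕ V))) (x : V) (r : Fin t) :
    vertexSum (lexProduct G (nullGraph t)) (blockLabeling ρ es t k) (x, r) =
      ∑ z ∈ (splitGraph G ρ).neighborFinset (.inl x), ∑ c : Fin t,
        cellLabel (t * t) (t * t * (2 * k)) (es.idxOf s(.inl x, z)) (finProdFinEquiv (r, c)) +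
      ∑ z ∈ (splitGraph G ρ).neighborFinset (.inr x), ∑ c : Fin t,
        cellLabel (t * t) (t * t * (2 * k)) (es.idxOf s(.inr x, z))
          (finProdFinEquiv (c, r)) := by
  classical
  rw [vertexSum_eq_sum_adj, sum_neighborFinset_inl x (fun z => ∑ c : Fin t,
        cellLabel (t * t) (t * t * (2 * k)) (es.idxOf s(.inl x, z)) (finProdFinEquiv (r, c))),
    sum_neighborFinset_inr x (fun z => ∑ c : Fin t, cellLabel (t * t) (t * t * (2 * k))
      (es.idxOf s(.inr x, z)) (finProdFinEquiv (c, r)))]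
  simp only [lexProduct_nullGraph_adj, sum_filter]
  rw [Fintype.sum_prod_type, ← sum_add_distrib]
  refine sum_congr rfl fun y _ => ?_
  by_cases hadj : G.Adj x y
  · rcases (hρ _ _ hadj).lt_or_gt with h | h
    · simp [hadj, h, h.not_gt, blockLabeling_of_lt, arcLabel]
    · simp only [hadj, h, h.not_gt, blockLabeling_of_gt, arcLabel, Sym2.eq_swap]
      simp
  · simp [hadj]

/-- The sum of the labels at a vertex of `G[O_t]`, in terms of the degrees of its two copies. -/
theorem vertexSum_blockLabeling_eq [DecidableRel (splitGraph G ρ).Adj]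
    (hρ : ∀ x y, G.Adj x y → ρ x ≠ ρ y) (hp : p.IsEulerian)
    (hk : p.length = 2 * k) (hk0 : 0 < k) {x : V} {d d' : ℕ}
    (hd : (splitGraph G ρ).degree (.inl x) = 2 * d)
    (hd' : (splitGraph G ρ).degree (.inr x) = 2 * d') (r : Fin t) :
    vertexSum (lexProduct G (nullGraph t)) (blockLabeling ρ p.edges t k) (x, r) +
        (if x = w then t * (t * t * k) else 0) =
      d * (t * (t * t * (2 * k) + 1)) + d' * (t * (t * t * (2 * k) + 1 + t * t)) := by
  classical
  rw [vertexSum_blockLabeling hρ,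
    sum_neighborFinset_idxOf hp _ (fun i => ∑ c : Fin t,
      cellLabel (t * t) (t * t * (2 * k)) i (finProdFinEquiv (r, c))),
    sum_neighborFinset_idxOf hp _ (fun i => ∑ c : Fin t,
      cellLabel (t * t) (t * t * (2 * k)) i (finProdFinEquiv (c, r)))]
  simp only [← sum_add_distrib, hk]
  rw [degree_eq_two_mul_card_getVert hp, hk] at hd hd'
  rw [add_assoc]
  congr 1
  · rw [← Nat.eq_of_mul_eq_mul_left two_pos hd]
    refine sum_const_nat fun i hi => ?_
    obtain ⟨hi, hiz⟩ := mem_filter.1 hi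
    rw [mem_range] at hi
    have hpar := splitGraph_isRight_getVert p (i := i) (by omega)
    rw [hiz] at hpar
    have hodd : ¬ Even i := by simpa using hpar
    have h0 : i ≠ 0 := by rintro rfl; simp at hodd
    rw [if_neg h0]
    simp only [cellLabel_add_pred_of_odd hi (Fin.is_lt _) hodd]
    simp
  -- Position `0` is a visit to the right copy of `w`, so the deficit can be charged to that single
  -- summand.
  · have hroot : (if x = w then t * (t * t * k) else 0) =
        ∑ i ∈ range (2 * k) with p.getVert i = .inr x, if i = 0 then t * (t * t * k) else 0 := by
      rw [sum_filter]
      obtain ⟨l, hl⟩ := Nat.exists_eq_succ_of_ne_zero (show 2 * k ≠ 0 by omega)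
      rw [hl, sum_range_succ']
      simp [eq_comm]
    rw [hroot, ← Nat.eq_of_mul_eq_mul_left two_pos hd', ← sum_add_distrib]
    refine sum_const_nat fun i hi => ?_
    obtain ⟨hi, hiz⟩ := mem_filter.1 hi
    rw [mem_range] at hi
    have hpar := splitGraph_isRight_getVert p (i := i) (by omega)
    rw [hiz] at hpar
    have heven : Even i := by simpa using hpar
    by_cases h0 : i = 0
    · subst h0
      have : t * (t * t * k) = ∑ c : Fin t, t * t * k := by simp
      rw [if_pos rfl, if_pos rfl, this, ← sum_add_distrib]
      simp only [cellLabel_zero_add_last hk0 (Fin.is_lt _)]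
      simp
    · rw [if_neg h0, if_neg h0]
      simp only [cellLabel_add_pred_of_even hi (Fin.is_lt _) heven h0]
      simp

end

theorem degree_le_length_of_isEulerian {V : Type*} [Fintype V] [DecidableEq V]
    {H : SimpleGraph V} [DecidableRel H.Adj] {u v : V} {p : H.Walk u v} (hp : p.IsEulerian)
    (x : V) : H.degree x ≤ p.length := by
  have h : #H.edgeFinset = p.length := by
    rw [← hp.edgesFinset_eq, ← p.length_edges]
    rfl
  rw [← h, ← card_incidenceFinset_eq_degree]
  exact card_le_card (H.incidenceFinset_subset x)

theorem degree_add_degree_le_length_of_isEulerian {V : Type*} [Fintype V] [DecidableEq V]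
    {H : SimpleGraph V} [DecidableRel H.Adj] {u v : V} {p : H.Walk u v} (hp : p.IsEulerian)
    {x y : V} (hne : x ≠ y) (hxy : ¬ H.Adj x y) : H.degree x + H.degree y ≤ p.length := by
  have h : #H.edgeFinset = p.length := by
    rw [← hp.edgesFinset_eq, ← p.length_edges]
    rfl
  rw [← h, ← card_incidenceFinset_eq_degree, ← card_incidenceFinset_eq_degree,
    ← card_union_of_disjoint]
  · exact card_le_card (union_subset (H.incidenceFinset_subset x) (H.incidenceFinset_subset y))
  · rw [Finset.disjoint_left]
    intro e hx hy
    rw [mem_incidenceFinset] at hx hy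
    exact hxy (H.adj_of_mem_incidenceSet hne hx hy)

/-! ### Degrees and connectivity of the split graph -/

namespace EvenTripartition

/-- The rank function that orders the three parts as `V₂ < {w} < V₃`. -/
def rank {V : Type*} [DecidableEq V] (w : V) (V₂ : Finset V) (x : V) : ℕ :=
  if x ∈ V₂ then 0 else if x = w then 1 else 2

theorem rank_of_mem₂ {V : Type*} [DecidableEq V] {w : V} {V₂ : Finset V} {x : V}
    (hx : x ∈ V₂) : rank w V₂ x = 0 := if_pos hx

theorem rank_le_two {V : Type*} [DecidableEq V] {w : V} {V₂ : Finset V} (x : V) :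
    rank w V₂ x ≤ 2 := by
  unfold rank
  split_ifs <;> omega

variable {V : Type*} [Fintype V] [DecidableEq V] {G : SimpleGraph V} [DecidableRel G.Adj]
  {w : V} {V₂ V₃ : Finset V} {a b m n : ℕ}

theorem mem_cases (hG : EvenTripartition G w V₂ V₃ a b m n) (x : V) :
    x = w ∨ x ∈ V₂ ∨ x ∈ V₃ := by
  have := Finset.mem_univ x
  rw [← hG.union_eq] at this
  simpa [or_assoc] using this

theorem rank_root (hG : EvenTripartition G w V₂ V₃ a b m n) : rank w V₂ w = 1 := by
  simp [rank, hG.not_mem₂]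

theorem rank_of_mem₃ (hG : EvenTripartition G w V₂ V₃ a b m n) {x : V} (hx : x ∈ V₃) :
    rank w V₂ x = 2 := by
  have h2 : x ∉ V₂ := fun h => Finset.disjoint_left.1 hG.disjoint h hx
  have hw : x ≠ w := by rintro rfl; exact hG.not_mem₃ hx
  simp [rank, h2, hw]

theorem rank_ne (hG : EvenTripartition G w V₂ V₃ a b m n) (x y : V) (h : G.Adj x y) :
    rank w V₂ x ≠ rank w V₂ y := by
  rcases hG.mem_cases x with rfl | hx | hx <;> rcases hG.mem_cases y with rfl | hy | hy
  · exact (G.irrefl h).elim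
  · simp [hG.rank_root, rank_of_mem₂ hy]
  · simp [hG.rank_root, hG.rank_of_mem₃ hy]
  · simp [hG.rank_root, rank_of_mem₂ hx]
  · exact (hG.indep₂ x hx y hy h).elim
  · simp [rank_of_mem₂ hx, hG.rank_of_mem₃ hy]
  · simp [hG.rank_root, hG.rank_of_mem₃ hx]
  · simp [rank_of_mem₂ hy, hG.rank_of_mem₃ hx]
  · exact (hG.indep₃ x hx y hy h).elim

section degrees

variable [DecidableRel (splitGraph G (rank w V₂)).Adj]

theorem degree_inl₂ (hG : EvenTripartition G w V₂ V₃ a b m n) {x : V} (hx : x ∈ V₂) :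
    (splitGraph G (rank w V₂)).degree (.inl x) = 2 * m := by
  rw [degree_splitGraph_inl, ← hG.degree₂ x hx, ← card_neighborFinset_eq_degree]
  congr 1
  ext y
  simp only [mem_filter, mem_univ, true_and, mem_neighborFinset, and_iff_left_iff_imp]
  intro h
  have := hG.rank_ne x y h
  rw [rank_of_mem₂ hx] at *
  omega

theorem degree_inr₂ {x : V} (hx : x ∈ V₂) :
    (splitGraph G (rank w V₂)).degree (.inr x) = 2 * 0 := by
  simp [degree_splitGraph_inr, rank_of_mem₂ hx]

theorem degree_inl₃ (hG : EvenTripartition G w V₂ V₃ a b m n) {x : V} (hx : x ∈ V₃) :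
    (splitGraph G (rank w V₂)).degree (.inl x) = 2 * 0 := by
  rw [degree_splitGraph_inl, hG.rank_of_mem₃ hx]
  simp [filter_eq_empty_iff, rank_le_two]

theorem degree_inr₃ (hG : EvenTripartition G w V₂ V₃ a b m n) {x : V} (hx : x ∈ V₃) :
    (splitGraph G (rank w V₂)).degree (.inr x) = 2 * n := by
  rw [degree_splitGraph_inr, ← hG.degree₃ x hx, ← card_neighborFinset_eq_degree]
  congr 1
  ext y
  simp only [mem_filter, mem_univ, true_and, mem_neighborFinset, and_iff_left_iff_imp]
  intro h
  have := hG.rank_ne x y h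
  have := rank_le_two (w := w) (V₂ := V₂) y
  rw [hG.rank_of_mem₃ hx] at *
  omega

theorem degree_inl_root (hG : EvenTripartition G w V₂ V₃ a b m n) :
    (splitGraph G (rank w V₂)).degree (.inl w) = 2 * b := by
  rw [degree_splitGraph_inl, ← hG.card_nbrs₃, hG.rank_root]
  congr 1
  ext y
  simp only [mem_filter, mem_univ, true_and, mem_inter, mem_neighborFinset]
  refine and_congr_right fun h => ?_
  rcases hG.mem_cases y with rfl | hy | hy
  · exact (G.irrefl h).elim
  · simp [rank_of_mem₂ hy, Finset.disjoint_left.1 hG.disjoint hy]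
  · simp [hG.rank_of_mem₃ hy, hy]

theorem degree_inr_root (hG : EvenTripartition G w V₂ V₃ a b m n) :
    (splitGraph G (rank w V₂)).degree (.inr w) = 2 * a := by
  rw [degree_splitGraph_inr, ← hG.card_nbrs₂, hG.rank_root]
  congr 1
  ext y
  simp only [mem_filter, mem_univ, true_and, mem_inter, mem_neighborFinset]
  refine and_congr_right fun h => ?_
  rcases hG.mem_cases y with rfl | hy | hy
  · exact (G.irrefl h).elim
  · simp [rank_of_mem₂ hy, hy]
  · simp [hG.rank_of_mem₃ hy, Finset.disjoint_right.1 hG.disjoint hy]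

theorem even_degree (hG : EvenTripartition G w V₂ V₃ a b m n) (z : V ⊕ V) :
    Even ((splitGraph G (rank w V₂)).degree z) := by
  rcases z with x | x <;> rcases hG.mem_cases x with rfl | hx | hx
  · simp [hG.degree_inl_root]
  · simp [hG.degree_inl₂ hx]
  · simp [hG.degree_inl₃ hx]
  · simp [hG.degree_inr_root]
  · simp [degree_inr₂ hx]
  · simp [hG.degree_inr₃ hx]

end degrees

/-- If the two copies of `w` were in different components, `G` would be bipartite. -/
theorem reachable_root (hG : EvenTripartition G w V₂ V₃ a b m n) (hchi : 2 < G.chromaticNumber) :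
    (splitGraph G (rank w V₂)).Reachable (.inr w) (.inl w) := by
  classical
  by_contra hnot
  let H := splitGraph G (rank w V₂)
  -- Colour by membership in the component of the right copy of `w`, negated on `V₃`. The value at
  -- `w` is consistent on both sides because its left copy lies outside that component.
  let color : V → Bool := fun x => if x = w then false else
    if x ∈ V₂ then decide (H.Reachable (.inr w) (.inl x))
    else !decide (H.Reachable (.inr w) (.inr x))
  have key : ∀ x y, G.Adj x y → rank w V₂ x < rank w V₂ y → color x ≠ color y := by
    intro x y h hlt
    have hH : H.Adj (.inl x) (.inr y) := ⟨h, hlt⟩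
    have hiff : H.Reachable (.inr w) (.inl x) ↔ H.Reachable (.inr w) (.inr y) :=
      ⟨fun h => h.trans hH.reachable, fun h => h.trans hH.symm.reachable⟩
    rcases hG.mem_cases x with rfl | hx | hx
    · have hy : y ∉ V₂ := fun hy => by simp [rank_of_mem₂ hy] at hlt
      have hyx : y ≠ x := h.ne'
      simp only [color, if_true, if_neg hy, if_neg hyx]
      have : ¬ H.Reachable (.inr x) (.inr y) := fun h => hnot (hiff.2 h)
      simp [this]
    · have hxw : x ≠ w := by rintro rfl; exact hG.not_mem₂ hx
      have hy : y ∉ V₂ := fun hy => hG.indep₂ x hx y hy h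
      by_cases hyw : y = w
      · subst hyw
        have : H.Reachable (.inr y) (.inl x) := hH.symm.reachable
        simp [color, hxw, hx, this]
      · simp only [color, if_neg hxw, if_pos hx, if_neg hyw, if_neg hy, hiff]
        simp
    · have := rank_le_two (w := w) (V₂ := V₂) y
      rw [hG.rank_of_mem₃ hx] at hlt
      omega
  have C : G.Coloring Bool := Coloring.mk color fun {x y} h => by
    rcases (hG.rank_ne x y h).lt_or_gt with hlt | hlt
    · exact key x y h hlt
    · exact (key y x h.symm hlt).symm
  have h2 : G.chromaticNumber ≤ 2 := by
    have := C.colorable.chromaticNumber_le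
    simpa using this
  exact absurd hchi h2.not_gt

theorem reachable_of_adj (hG : EvenTripartition G w V₂ V₃ a b m n) (hconn : G.Connected)
    (hchi : 2 < G.chromaticNumber) (z z' : V ⊕ V)
    (h : (splitGraph G (rank w V₂)).Adj z z') :
    (splitGraph G (rank w V₂)).Reachable (.inr w) z := by
  let H := splitGraph G (rank w V₂)
  have hroot : H.Reachable (.inr w) (.inl w) := hG.reachable_root hchi
  -- A walk in `G` to `w` lifts to the split graph, since a vertex of `V₂` or `V₃` has all its edges
  -- at one copy; when the walk meets `w`, `hroot` bridges its two copies.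
  have key : ∀ {x y : V}, G.Walk x y → y = w → (x ∈ V₂ → H.Reachable (.inr w) (.inl x)) ∧
      (x ∈ V₃ → H.Reachable (.inr w) (.inr x)) := by
    intro x y p hy
    induction p with
    | nil => exact ⟨fun h => (hG.not_mem₂ (hy ▸ h)).elim, fun h => (hG.not_mem₃ (hy ▸ h)).elim⟩
    | @cons x x' _ h p ih =>
      obtain ⟨ih2, ih3⟩ := ih hy
      constructor
      · intro hx
        have hlt : rank w V₂ x < rank w V₂ x' := by
          have := hG.rank_ne x x' h
          rw [rank_of_mem₂ hx] at *
          omega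
        have hadj : H.Adj (.inr x') (.inl x) := ⟨h, hlt⟩
        rcases hG.mem_cases x' with rfl | hx' | hx'
        · exact hadj.reachable
        · exact (hG.indep₂ x hx x' hx' h).elim
        · exact (ih3 hx').trans hadj.reachable
      · intro hx
        have hlt : rank w V₂ x' < rank w V₂ x := by
          have := hG.rank_ne x x' h
          have := rank_le_two (w := w) (V₂ := V₂) x'
          rw [hG.rank_of_mem₃ hx] at *
          omega
        have hadj : H.Adj (.inl x') (.inr x) := ⟨h.symm, hlt⟩
        rcases hG.mem_cases x' with rfl | hx' | hx'
        · exact hroot.trans hadj.reachable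
        · exact (ih2 hx').trans hadj.reachable
        · exact (hG.indep₃ x hx x' hx' h).elim
  have side : ∀ {x y : V}, G.Adj x y → rank w V₂ x < rank w V₂ y →
      H.Reachable (.inr w) (.inl x) := by
    intro x y _ hlt
    obtain ⟨p⟩ := hconn.preconnected x w
    rcases hG.mem_cases x with rfl | hx | hx
    · exact hroot
    · exact (key p rfl).1 hx
    · have := rank_le_two (w := w) (V₂ := V₂) y
      rw [hG.rank_of_mem₃ hx] at hlt
      omega
  rcases z with x | x <;> rcases z' with y | y
  · exact h.elim
  · exact side h.1 h.2
  · exact (side h.1 h.2).trans h.symm.reachable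
  · exact h.elim

end EvenTripartition

/-! ### The lower bound, and separation of the three sums -/

theorem chromaticNumber_le_numColors {V : Type*} [Fintype V] {G : SimpleGraph V} {t : ℕ}
    (ht : 0 < t) {f : Sym2 (V × Fin t) → ℕ}
    (hf : IsLocalAntimagic (lexProduct G (nullGraph t)) f) :
    G.chromaticNumber ≤ numColors (lexProduct G (nullGraph t)) f := by
  let g := vertexSum (lexProduct G (nullGraph t)) f
  let C : G.Coloring (Set.range g) :=
    Coloring.mk (fun x => ⟨g (x, ⟨0, ht⟩), Set.mem_range_self _⟩) fun {x y} h he =>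
      hf.vertexSum_ne (x, ⟨0, ht⟩) (y, ⟨0, ht⟩) (lexProduct_nullGraph_adj.2 h)
        (congrArg Subtype.val he)
  have : Fintype (Set.range g) := Fintype.ofFinite _
  have h := C.colorable.chromaticNumber_le
  rwa [← Nat.card_eq_fintype_card, Nat.card_coe_set_eq] at h

/-- Modulo `M = T * (2 * k) + 1` the difference is `T * n`, strictly between `0` and `M`. The next
two lemmas argue likewise, with `T * (k - a)` and `T * (n + k - a)`. -/
theorem mul_ne_mul_add {T k m n : ℕ} (hT : 0 < T) (hn : 0 < n) (hnk : n ≤ k) :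
    m * (T * (2 * k) + 1) ≠ n * (T * (2 * k) + 1 + T) := by
  have h1 : T * n ≤ T * k := Nat.mul_le_mul_left T hnk
  have h2 : 0 < T * n := Nat.mul_pos hT hn
  intro h
  rcases le_or_gt m n with hmn | hmn
  · nlinarith [Nat.mul_le_mul_right (T * (2 * k) + 1) hmn]
  · nlinarith [Nat.mul_le_mul_right (T * (2 * k) + 1) hmn]

theorem mul_add_ne_of_lt {T k m a b : ℕ} (hT : 0 < T) (hak : a < k) :
    m * (T * (2 * k) + 1) + T * k ≠
      b * (T * (2 * k) + 1) + a * (T * (2 * k) + 1 + T) := by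
  have h1 : T * a < T * k := Nat.mul_lt_mul_of_pos_left hak hT
  intro h
  rcases le_or_gt (a + b) m with hmn | hmn
  · nlinarith [Nat.mul_le_mul_right (T * (2 * k) + 1) hmn]
  · nlinarith [Nat.mul_le_mul_right (T * (2 * k) + 1) hmn]

theorem mul_add_add_ne_of_lt {T k n a b : ℕ} (hT : 0 < T) (ha : 0 < a) (hak : a < k)
    (hnk : n ≤ k) :
    n * (T * (2 * k) + 1 + T) + T * k ≠
      b * (T * (2 * k) + 1) + a * (T * (2 * k) + 1 + T) := by
  have h1 : T * a < T * k := Nat.mul_lt_mul_of_pos_left hak hT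
  have h2 : T * n ≤ T * k := Nat.mul_le_mul_left T hnk
  have h3 : 0 < T * a := Nat.mul_pos hT ha
  intro h
  rcases le_or_gt (a + b) n with hmn | hmn
  · nlinarith [Nat.mul_le_mul_right (T * (2 * k) + 1) hmn]
  · nlinarith [Nat.mul_le_mul_right (T * (2 * k) + 1) hmn]

/-- The block labeling along an Eulerian circuit of the split graph is local antimagic and induces
at most three colors. -/
theorem EvenTripartition.exists_isLocalAntimagic {V : Type*} [Fintype V] [DecidableEq V]
    {G : SimpleGraph V} [DecidableRel G.Adj] {w : V} {V₂ V₃ : Finset V} {a b m n : ℕ}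
    (hG : EvenTripartition G w V₂ V₃ a b m n) (hconn : G.Connected)
    (hchi : 2 < G.chromaticNumber) {t : ℕ} (ht : 0 < t) :
    ∃ f, IsLocalAntimagic (lexProduct G (nullGraph t)) f ∧
      numColors (lexProduct G (nullGraph t)) f ≤ 3 := by
  classical
  obtain ⟨p, hp⟩ := exists_closed_isEulerian (splitGraph G (rank w V₂)) (.inr w)
    hG.even_degree (hG.reachable_of_adj hconn hchi)
  obtain ⟨k, hk⟩ : ∃ k, p.length = 2 * k := by
    have := splitGraph_isRight_getVert p le_rfl
    rw [p.getVert_length] at this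
    exact (this.1 rfl).two_dvd
  -- The two copies of `w` share no edge; with `b ≥ 1` this yields the strict inequality `a < k`.
  have hab : 2 * b + 2 * a ≤ 2 * k := by
    rw [← hG.degree_inl_root, ← hG.degree_inr_root, ← hk]
    exact degree_add_degree_le_length_of_isEulerian hp Sum.inl_ne_inr
      fun h => G.irrefl h.1
  have ha := hG.one_le_a
  have hb := hG.one_le_b
  have hT : 0 < t * t := Nat.mul_pos ht ht
  let f := blockLabeling (rank w V₂) p.edges t k
  let S := vertexSum (lexProduct G (nullGraph t)) f
  have hS := @vertexSum_blockLabeling_eq V _ _ G (rank w V₂) w p t k _ hG.rank_ne hp hk (by omega)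
  have hS1 : ∀ r, S (w, r) + t * (t * t * k) =
      t * (b * (t * t * (2 * k) + 1) + a * (t * t * (2 * k) + 1 + t * t)) := by
    intro r
    have := hS hG.degree_inl_root hG.degree_inr_root r
    rw [if_pos rfl] at this
    exact this.trans (by ring)
  have hS2 : ∀ x ∈ V₂, ∀ r, S (x, r) = t * (m * (t * t * (2 * k) + 1)) := by
    intro x hx r
    have := hS (hG.degree_inl₂ hx) (degree_inr₂ hx) r
    rw [if_neg (by rintro rfl; exact hG.not_mem₂ hx)] at this
    exact this.trans (by ring)
  have hS3 : ∀ x ∈ V₃, ∀ r, S (x, r) = t * (n * (t * t * (2 * k) + 1 + t * t)) := by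
    intro x hx r
    have := hS (hG.degree_inl₃ hx) (hG.degree_inr₃ hx) r
    rw [if_neg (by rintro rfl; exact hG.not_mem₃ hx)] at this
    exact this.trans (by ring)
  have hn : ∀ x ∈ V₃, n ≤ k := by
    intro x hx
    have := degree_le_length_of_isEulerian hp (.inr x)
    rw [hG.degree_inr₃ hx, hk] at this
    omega
  have h12 : ∀ x ∈ V₂, ∀ r s, S (w, r) ≠ S (x, s) := by
    intro x hx r s h
    have h1 := hS1 r
    rw [h, hS2 x hx, ← mul_add] at h1
    exact mul_add_ne_of_lt hT (by omega) (Nat.eq_of_mul_eq_mul_left ht h1)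
  have h13 : ∀ x ∈ V₃, ∀ r s, S (w, r) ≠ S (x, s) := by
    intro x hx r s h
    have h1 := hS1 r
    rw [h, hS3 x hx, ← mul_add] at h1
    exact mul_add_add_ne_of_lt hT ha (by omega) (hn x hx) (Nat.eq_of_mul_eq_mul_left ht h1)
  have h23 : ∀ x ∈ V₂, ∀ y ∈ V₃, G.Adj x y → ∀ r s, S (x, r) ≠ S (y, s) := by
    intro x hx y hy hxy r s h
    rw [hS2 x hx, hS3 y hy] at h
    have hpos : 0 < G.degree y := (G.degree_pos_iff_exists_adj y).2 ⟨x, hxy.symm⟩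
    rw [hG.degree₃ y hy] at hpos
    exact mul_ne_mul_add hT (by omega) (hn y hy) (Nat.eq_of_mul_eq_mul_left ht h)
  refine ⟨f, ⟨?_, ?_⟩, ?_⟩
  · have hbij := blockLabeling_bijOn (t := t) hG.rank_ne hp hk
    -- The bijection onto an interval itself supplies the edge count.
    have hcard : (lexProduct G (nullGraph t)).edgeSet.ncard = t * t * (2 * k) := by
      rw [← hbij.injOn.ncard_image, hbij.image_eq, ← Finset.coe_Icc,
        Set.ncard_coe_finset, Nat.card_Icc]
      omega
    rw [hcard]
    exact hbij
  · rintro ⟨x, r⟩ ⟨y, s⟩ h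
    rw [lexProduct_nullGraph_adj] at h
    change S (x, r) ≠ S (y, s)
    rcases hG.mem_cases x with rfl | hx | hx <;> rcases hG.mem_cases y with rfl | hy | hy
    · exact (G.irrefl h).elim
    · exact h12 y hy r s
    · exact h13 y hy r s
    · exact (h12 x hx s r).symm
    · exact (hG.indep₂ x hx y hy h).elim
    · exact h23 x hx y hy h r s
    · exact (h13 x hx s r).symm
    · exact (h23 y hy x hx h.symm s r).symm
    · exact (hG.indep₃ x hx y hy h).elim
  · have hsub : Set.range S ⊆ ({S (w, ⟨0, ht⟩), t * (m * (t * t * (2 * k) + 1)),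
        t * (n * (t * t * (2 * k) + 1 + t * t))} : Finset ℕ) := by
      rintro _ ⟨⟨x, r⟩, rfl⟩
      rcases hG.mem_cases x with rfl | hx | hx
      · have : S (x, r) = S (x, ⟨0, ht⟩) := by
          have h1 := hS1 r
          have h2 := hS1 ⟨0, ht⟩
          omega
        simp [this]
      · simp [hS2 x hx]
      · simp [hS3 x hx]
    refine (Set.ncard_le_ncard hsub (Finset.finite_toSet _)).trans ?_
    rw [Set.ncard_coe_finset]
    exact Finset.card_le_three

end LocalAntimagic

theorem mainTheorem6 {V : Type*} [Fintype V] [DecidableEq V] (G : SimpleGraph V)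
    [DecidableRel G.Adj] (w : V) (V₂ V₃ : Finset V) (a b m n : ℕ)
    (hEuler : LocalAntimagic.IsEulerianGraph G) (hchi : G.chromaticNumber = 3)
    (hG : LocalAntimagic.EvenTripartition G w V₂ V₃ a b m n) (t : ℕ) (ht : 3 ≤ t) :
    LocalAntimagic.chiLa
      (LocalAntimagic.lexProduct G (LocalAntimagic.nullGraph t)) = 3 := by
  refine le_antisymm ?_ ?_
  · obtain ⟨f, hf, hcard⟩ := hG.exists_isLocalAntimagic hEuler.1
      (by rw [hchi]; norm_num) (t := t) (by omega)
    exact iInf₂_le_of_le f hf (by exact_mod_cast hcard)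
  · refine le_iInf₂ fun f hf => ?_
    rw [← hchi]
    exact LocalAntimagic.chromaticNumber_le_numColors (by omega) hf
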